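/- Let $d\ge 1$ and $N\ge 1$ be integers, and let $c(x_1,\dots,x_N)=\sum_{1\le i<j\le N}\frac{1}{|x_i-x_j|}\in[0,+\infty]$ on $(\mathbb{R}^d)^N$ (with $1/0=+\infty$). For a Borel probability measure $\rho$ on $\mathbb{R}^d$ put $$C(\rho)=\inf\Big\{\int c\,dP \;:\; P\in\mathcal P((\mathbb{R}^d)^N)\text{ with all } N \text{ marginals on } \mathbb{R}^d \text{ equal to } \rho\Big\},$$ and for a Borel measure $\rho\ge 0$ on $\mathbb{R}^d$ with mass $\|\rho\|\le 1$ put $$\overline{C}(\rho)=\inf\Big\{\liminf_{n\to\infty} C(\rho_n)\;:\;\rho_n \text{ Borel probabilities on } \mathbb{R}^d,\ \int f\,d\rho_n\to\int f\,d\rho \text{ for every } f\in C_0(\mathbb{R}^d)\Big\}.$$ Let $X=\mathbb{R}^d\cup\{\omega\}$ be the one-point compactification of $\mathbb{R}^d$, and extend $c$ to $X^N$ by setting $\frac{1}{|a-b|}=0$ whenever $a=\omega$ or $b=\omega$. For $\rho$ as above let $\tilde\rho=\rho+(1-\|\rho\|)\delta_\omega$, a Borel probability measure on $X$. (i) For every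 Borel measure $\rho\ge0$ on $\mathbb{R}^d$ with $\|\rho\|\le1$, $$\overline{C}(\rho)=\sup\Big\{\int_X u\,d\tilde\rho\;:\;\frac1N\sum_{i=1}^N u(x_i)\le c(x)\ \text{ for } \tilde\rho^{\otimes N}\text{-a.e. } x\in X^N\Big\},$$ both when the supremum is taken over all lower semicontinuous functions $u:X\to\mathbb{R}$ and when it is taken over all continuous functions $u:X\to\mathbb{R}$ (the values lie in $[0,+\infty]$; the integral of a lower semicontinuous $u$, which is bounded below, may be $+\infty$). (ii) In particular, for finitely supported $\rho=\sum_{i=1}^K\alpha_i\delta_{a_i}$, where $K\ge 0$, the points $a_1,\dots,a_K\in\mathbb{R}^d$ are distinct, $\alpha_i\ge0$ and $\sum_i\alpha_i\le1$, the number $\overline{C}(\rho)$ is the value of a linear program: with $a_{K+1}=\omega$ and $\alpha_{K+1}=1-\sum_{i=1}^K\alpha_i$, $$\overline{C}(\rho)=\sup\Big\{\sum_{k=1}^{K+1}\alpha_k y_k\;:\;y\in\mathbb{R}^{K+1},\ \frac1N\sum_{i=1}^N y_{j_i}\le c(a_{j_1},\dots,a_{j_N})\ \text{ for all } j\in\{1,\dots,K+1\}^N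 \text{ with } \alpha_{j_1},\dots,\alpha_{j_N}>0\Big\},$$ where a constraint with right-hand side $+\infty$ is void. -/

import Mathlib

open MeasureTheory Filter Topology

open scoped ENNReal ZeroAtInfty

/-- The Euclidean space `ℝ^d`. -/
abbrev Eu (d : ℕ) : Type := EuclideanSpace ℝ (Fin d)

/-- The one-point compactification `X = ℝ^d ∪ {ω}`. -/
abbrev CompEu (d : ℕ) : Type := OnePoint (Eu d)

/-- `X` carries its Borel σ-algebra. -/
instance instMeasurableSpaceCompEu (d : ℕ) : MeasurableSpace (CompEu d) := borel _

instance instBorelSpaceCompEu (d : ℕ) : BorelSpace (CompEu d) := ⟨rfl⟩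

noncomputable section

/-- The Coulomb cost `c(x₁,…,x_N) = ∑_{i<j} 1 / |x_i - x_j|` on `(ℝ^d)^N`, with `1 / 0 = +∞`. -/
def coulombCost {d N : ℕ} (x : Fin N → Eu d) : ℝ≥0∞ :=
  ∑ i : Fin N, ∑ j ∈ Finset.Ioi i, (edist (x i) (x j))⁻¹

/-- `1 / |a - b|` on `X`, with value `0` as soon as `a` or `b` is the point at infinity. -/
def compInvDist {d : ℕ} : CompEu d → CompEu d → ℝ≥0∞
  | some a, some b => (edist a b)⁻¹
  | _, _ => 0

/-- The extended Coulomb cost on `X^N`. -/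
def compCoulombCost {d N : ℕ} (x : Fin N → CompEu d) : ℝ≥0∞ :=
  ∑ i : Fin N, ∑ j ∈ Finset.Ioi i, compInvDist (x i) (x j)

/-- `P` is a multi-marginal transport plan: a probability on `(ℝ^d)^N`, all of whose `N`
one-body marginals are `ρ`. -/
def IsPlan {d N : ℕ} (ρ : Measure (Eu d)) (P : Measure (Fin N → Eu d)) : Prop :=
  IsProbabilityMeasure P ∧ ∀ i : Fin N, P.map (fun x => x i) = ρ

/-- The multi-marginal transport cost `C(ρ)`. -/
def transportCost {d : ℕ} (N : ℕ) (ρ : Measure (Eu d)) : ℝ≥0∞ :=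
  ⨅ (P : Measure (Fin N → Eu d)) (_ : IsPlan ρ P), ∫⁻ x, coulombCost x ∂P

/-- Weak* convergence of measures on `ℝ^d`, tested against continuous functions vanishing
at infinity. -/
def WeakStarTendsto {d : ℕ} (σ : ℕ → ProbabilityMeasure (Eu d)) (ρ : Measure (Eu d)) : Prop :=
  ∀ f : C₀(Eu d, ℝ),
    Tendsto (fun n => ∫ x, f x ∂(σ n : Measure (Eu d))) atTop (𝓝 (∫ x, f x ∂ρ))

/-- The relaxed cost: the infimum of `liminf C(ρ_n)` over the sequences of probabilities
`ρ_n` that converge weakly* to `ρ`. -/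
def relaxedCost {d : ℕ} (N : ℕ) (ρ : Measure (Eu d)) : ℝ≥0∞ :=
  ⨅ (σ : ℕ → ProbabilityMeasure (Eu d)) (_ : WeakStarTendsto σ ρ),
    liminf (fun n => transportCost N (σ n : Measure (Eu d))) atTop

/-- `ρ̃ = ρ + (1 - ‖ρ‖) δ_ω`, a probability on `X` when `ρ` is a sub-probability on `ℝ^d`. -/
def compMeasure {d : ℕ} (ρ : Measure (Eu d)) : Measure (CompEu d) :=
  ρ.map (fun x : Eu d => (x : CompEu d)) +
    (1 - ρ Set.univ) • Measure.dirac (OnePoint.infty : CompEu d)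

/-- The integral `∫ u dμ` with values in `[-∞, +∞]`, as integral of the positive part minus
integral of the negative part; the latter is finite when `u` is bounded below and `μ` is finite. -/
def extIntegral {α : Type*} [MeasurableSpace α] (μ : Measure α) (u : α → ℝ) : EReal :=
  ((∫⁻ x, ENNReal.ofReal (u x) ∂μ : ℝ≥0∞) : EReal) -
    ((∫⁻ x, ENNReal.ofReal (-u x) ∂μ : ℝ≥0∞) : EReal)

/-- The weak dual constraint: `(1/N) ∑ u(x_i) ≤ c(x)` for `μ^{⊗N}`-almost every `x ∈ X^N`. -/
def WeakDualAdmissible {d : ℕ} (N : ℕ) (μ : Measure (CompEu d)) (u : CompEu d → ℝ) : Prop :=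
  ∀ᵐ x ∂(Measure.pi fun _ : Fin N => μ),
    (((1 / (N : ℝ)) * ∑ i, u (x i) : ℝ) : EReal) ≤ ((compCoulombCost x : ℝ≥0∞) : EReal)

/-- The measure `∑ α_i δ_{a_i}`. -/
def atomicMeasure {d K : ℕ} (a : Fin K → Eu d) (α : Fin K → ℝ) : Measure (Eu d) :=
  ∑ i, ENNReal.ofReal (α i) • Measure.dirac (a i)

/-- The `K + 1` points `a_1, …, a_K, ω` of `X`; the index `none` stands for `ω`. -/
def atomNode {d K : ℕ} (a : Fin K → Eu d) : Option (Fin K) → CompEu d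
  | some i => (a i : CompEu d)
  | none => OnePoint.infty

/-- The `K + 1` weights `α_1, …, α_K, 1 - ∑ α_i`. -/
def atomWeight {K : ℕ} (α : Fin K → ℝ) : Option (Fin K) → ℝ
  | some i => α i
  | none => 1 - ∑ i, α i

/-- The linear constraints on the vector `y ∈ ℝ^{K+1}`, one for each `N`-tuple of the points
`a_1, …, a_K, ω` with positive weights (a constraint with infinite right-hand side is void). -/
def LPFeasible {d K : ℕ} (N : ℕ) (a : Fin K → Eu d) (α : Fin K → ℝ)
    (y : Option (Fin K) → ℝ) : Prop :=
  ∀ j : Fin N → Option (Fin K), (∀ i, 0 < atomWeight α (j i)) →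
    (((1 / (N : ℝ)) * ∑ i, y (j i) : ℝ) : EReal) ≤
      ((compCoulombCost (fun i => atomNode a (j i)) : ℝ≥0∞) : EReal)

end

/-! ### Duality for averaged marginals on a compact space -/

/-- A lower semicontinuous `[0, ∞]`-valued function on a normal second countable space is the
pointwise supremum of an increasing sequence of nonnegative continuous real functions. -/
theorem exists_monotone_continuous_iSup_eq {Y : Type*} [TopologicalSpace Y] [T4Space Y]
    [SecondCountableTopology Y] {g : Y → ℝ≥0∞} (hg : LowerSemicontinuous g) :
    ∃ f : ℕ → C(Y, ℝ), Monotone f ∧ (∀ n, 0 ≤ f n) ∧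
      ∀ x, ⨆ n, ENNReal.ofReal (f n x) = g x := by
  let F : Set (Y → ℝ≥0∞) :=
    {φ | ∃ f : C(Y, ℝ), 0 ≤ f ∧ (φ = fun x => ENNReal.ofReal (f x)) ∧ φ ≤ g}
  have hcont : ∀ φ ∈ F, LowerSemicontinuous φ := by
    rintro φ ⟨f, -, rfl, -⟩
    exact (ENNReal.continuous_ofReal.comp f.continuous).lowerSemicontinuous
  have hlub : IsLUB F g := by
    refine ⟨fun φ ⟨_, _, _, h⟩ => h, fun ψ hψ x => ?_⟩
    refine le_of_forall_lt fun r hr => ?_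
    obtain ⟨s, hrs, hsg⟩ := exists_between hr
    have hs : s ≠ ⊤ := (hsg.trans_le le_top).ne
    have hopen : IsOpen {y | s < g y} := hg.isOpen_preimage s
    -- An Urysohn function equal to 1 at `x` and 0 off `{s < g}`; multiplied by `s` it lies below
    -- `g` and attains `s` at `x`.
    obtain ⟨h, h0, h1, h01⟩ := exists_continuous_zero_one_of_isClosed
      (s := {y | s < g y}ᶜ) (t := {x}) hopen.isClosed_compl isClosed_singleton
      (by simpa using hsg)
    have hmem : (fun y => ENNReal.ofReal ((s.toReal • h) y)) ∈ F := by
      refine ⟨s.toReal • h, fun y => mul_nonneg ENNReal.toReal_nonneg (h01 y).1, rfl,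
        fun y => ?_⟩
      by_cases hy : s < g y
      · refine le_trans ?_ hy.le
        rw [ENNReal.ofReal_le_iff_le_toReal hs]
        simpa using mul_le_of_le_one_right ENNReal.toReal_nonneg (h01 y).2
      · simp [h0 (show y ∈ {y | s < g y}ᶜ from hy)]
    have := hψ hmem x
    simp only [ContinuousMap.smul_apply, h1 rfl, Pi.one_apply, smul_eq_mul, mul_one,
      ENNReal.ofReal_toReal hs] at this
    exact hrs.trans_le this
  obtain ⟨F', hF', hF'c, hF'lub⟩ := exists_countable_lowerSemicontinuous_isLUB hcont hlub
  -- The zero function is added so that the countable family is nonempty and can be enumerated by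
  -- `ℕ`.
  have hne : (insert (fun _ => 0) F').Nonempty := Set.insert_nonempty _ _
  obtain ⟨φ, hφ⟩ := (hF'c.insert (fun _ => 0)).exists_eq_range hne
  have hφF : ∀ n, φ n ∈ F := by
    intro n
    have : φ n ∈ insert (fun _ => 0) F' := hφ ▸ Set.mem_range_self n
    rcases this with h | h
    · exact ⟨0, le_rfl, by ext; simp [h], by rw [h]; exact fun _ => zero_le⟩
    · exact hF' h
  choose f hf0 hf hfg using hφF
  refine ⟨partialSups f, (partialSups f).monotone,
    fun n => (hf0 n).trans (le_partialSups f n), fun x => le_antisymm ?_ ?_⟩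
  · refine iSup_le fun n => ?_
    have key : ∀ n, ENNReal.ofReal (partialSups f n x) ≤ g x := by
      intro n
      induction n with
      | zero => simpa [hf] using hfg 0 x
      | succ n ih =>
        rw [partialSups_add_one, ContinuousMap.sup_apply, ENNReal.ofReal_max]
        exact max_le ih (by simpa [hf] using hfg (n + 1) x)
    exact key n
  · have : g ≤ fun x => ⨆ n, ENNReal.ofReal (partialSups f n x) := by
      refine hF'lub.2 fun ψ hψ x => ?_
      obtain ⟨n, rfl⟩ : ψ ∈ Set.range φ := hφ ▸ Set.mem_insert_of_mem _ hψ
      rw [hf n]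
      exact le_iSup_of_le n (ENNReal.ofReal_le_ofReal (le_partialSups f n x))
    exact this x

theorem integrable_continuousMap {Y : Type*} [TopologicalSpace Y] [CompactSpace Y]
    [MeasurableSpace Y] [OpensMeasurableSpace Y] (P : Measure Y) [IsFiniteMeasure P]
    (f : C(Y, ℝ)) : Integrable f P :=
  (BoundedContinuousFunction.mkOfCompact f).integrable P

/-- Positive linear functionals on `C(Y)`, for `Y` compact, are represented by finite measures. -/
theorem exists_measure_integral_eq {Y : Type*} [TopologicalSpace Y] [CompactSpace Y] [T2Space Y]
    [MeasurableSpace Y] [BorelSpace Y] (L : C(Y, ℝ) →ₗ[ℝ] ℝ) (hL : ∀ f, 0 ≤ f → 0 ≤ L f) :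
    ∃ P : Measure Y, IsFiniteMeasure P ∧ ∀ f : C(Y, ℝ), ∫ x, f x ∂P = L f := by
  let Λ : CompactlySupportedContinuousMap Y ℝ →ₚ[ℝ] ℝ :=
  { toFun g := L g.toContinuousMap
    map_add' g g' := L.map_add _ _
    map_smul' c g := L.map_smul _ _
    monotone' g g' hgg' := by
      have := hL (g'.toContinuousMap - g.toContinuousMap) (fun x => sub_nonneg.2 (hgg' x))
      rw [map_sub] at this
      exact sub_nonneg.1 this }
  refine ⟨RealRMK.rieszMeasure Λ, by infer_instance, fun f ↦ ?_⟩
  let g : CompactlySupportedContinuousMap Y ℝ :=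
  { toFun := f
    hasCompactSupport' := HasCompactSupport.of_compactSpace _ }
  exact RealRMK.integral_rieszMeasure Λ g

noncomputable section

/-- The continuous function `x ↦ (1/N) ∑ u(x_i)` on `X^N`. -/
def meanMap {X : Type*} [TopologicalSpace X] (N : ℕ) : C(X, ℝ) →ₗ[ℝ] C(Fin N → X, ℝ) where
  toFun u := ⟨fun x => (1 / (N : ℝ)) * ∑ i, u (x i), by fun_prop⟩
  map_add' u v := by ext x; simp [Finset.sum_add_distrib, mul_add]
  map_smul' c u := by ext x; simp [← Finset.mul_sum]; ring

end

theorem meanMap_apply {X : Type*} [TopologicalSpace X] {N : ℕ} (u : C(X, ℝ)) (x : Fin N → X) :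
    meanMap N u x = (1 / (N : ℝ)) * ∑ i, u (x i) := rfl

theorem meanMap_const {X : Type*} [TopologicalSpace X] {N : ℕ} (hN : 1 ≤ N) (r : ℝ) :
    meanMap N (ContinuousMap.const X r) = ContinuousMap.const _ r := by
  ext x
  have : (N : ℝ) ≠ 0 := by positivity
  simp [meanMap_apply, this]

/-- Strong duality for the multi-marginal problem with lower semicontinuous cost on a compact
metrizable space: if the dual value is at most `D`, there is a plan of cost at most `D`. -/
theorem exists_plan_of_dual_le {X : Type*} [TopologicalSpace X] [CompactSpace X] [T2Space X]
    [SecondCountableTopology X] [MeasurableSpace X] [BorelSpace X] {N : ℕ} (hN : 1 ≤ N)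
    (μ : Measure X) [IsProbabilityMeasure μ] {c : (Fin N → X) → ℝ≥0∞}
    (hc : LowerSemicontinuous c) (D : ℝ)
    (hD : ∀ u : C(X, ℝ), (∀ x, c x ≠ ⊤ → meanMap N u x ≤ (c x).toReal) → ∫ x, u x ∂μ ≤ D) :
    ∃ P : Measure (Fin N → X), IsProbabilityMeasure P ∧
      (∀ u : C(X, ℝ), ∫ x, meanMap N u x ∂P = ∫ x, u x ∂μ) ∧
      ∫⁻ x, c x ∂P ≤ ENNReal.ofReal D := by
  have hint : ∀ u : C(X, ℝ), Integrable u μ := integrable_continuousMap μ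
  have hD0 : 0 ≤ D := by simpa using hD 0 (fun x _ => by simp)
  have hscale : ∀ (u : C(X, ℝ)) (t : ℝ), 0 < t →
      (∀ x, c x ≠ ⊤ → meanMap N u x ≤ t * (c x).toReal) → ∫ x, u x ∂μ ≤ t * D := by
    intro u t ht h
    have := hD (t⁻¹ • u) fun x hx => by
      rw [map_smul, ContinuousMap.smul_apply, smul_eq_mul, inv_mul_le_iff₀ ht]
      exact h x hx
    simp only [ContinuousMap.smul_apply, smul_eq_mul, integral_const_mul] at this
    rwa [inv_mul_le_iff₀ ht] at this
  -- The infimum of `A f` is the least price at which `f` is dominated by a separable function plus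
  -- a multiple of the cost. It is sublinear in `f`, and a linear functional below it is integration
  -- against the desired plan. Requiring `t > 0` lets `hscale` divide by `t`.
  let A : C(Fin N → X, ℝ) → Set ℝ := fun f => {r | ∃ (u : C(X, ℝ)) (t : ℝ), 0 < t ∧
    (∀ x, c x ≠ ⊤ → f x ≤ meanMap N u x + t * (c x).toReal) ∧ r = ∫ x, u x ∂μ + t * D}
  -- The dual bound enters here: it keeps the infimum finite, and nonnegative at `f = 0`.
  have hlow : ∀ f, ∀ r ∈ A f, -‖f‖ ≤ r := by
    rintro f r ⟨u, t, ht, h, rfl⟩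
    have := hscale (-(u + ContinuousMap.const X ‖f‖)) t ht fun x hx => by
      have h1 := h x hx
      have h2 := (abs_le.1 (f.norm_coe_le_norm x)).1
      rw [map_neg, map_add, meanMap_const hN]
      simp only [ContinuousMap.neg_apply, ContinuousMap.add_apply, ContinuousMap.const_apply]
      linarith
    have h3 : ∫ x, (-(u + ContinuousMap.const X ‖f‖)) x ∂μ = -(∫ x, u x ∂μ + ‖f‖) := by
      simp only [ContinuousMap.neg_apply, ContinuousMap.add_apply, ContinuousMap.const_apply]
      rw [integral_neg, integral_add (hint u) (integrable_const _)]
      simp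
    linarith
  have hbdd : ∀ f, BddBelow (A f) := fun f => ⟨_, hlow f⟩
  have hne : ∀ f, (A f).Nonempty := fun f =>
    ⟨_, ContinuousMap.const X ‖f‖, 1, one_pos, fun x _ => by
      rw [meanMap_const hN]
      have h2 := (abs_le.1 (f.norm_coe_le_norm x)).2
      have : 0 ≤ (c x).toReal := ENNReal.toReal_nonneg
      simp only [ContinuousMap.const_apply]
      linarith, rfl⟩
  have hsmul_mem : ∀ (s : ℝ), 0 < s → ∀ f, ∀ r ∈ A f, s * r ∈ A (s • f) := by
    rintro s hs f r ⟨u, t, ht, h, rfl⟩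
    refine ⟨s • u, s * t, by positivity, fun x hx => ?_, ?_⟩
    · have := mul_le_mul_of_nonneg_left (h x hx) hs.le
      simp only [map_smul, ContinuousMap.smul_apply, smul_eq_mul]
      linarith
    · simp only [ContinuousMap.smul_apply, smul_eq_mul, integral_const_mul]
      ring
  -- Hahn–Banach, starting from the zero functional on the trivial subspace.
  obtain ⟨L, -, hL⟩ := exists_extension_of_le_sublinear
    (⟨⊥, 0⟩ : C(Fin N → X, ℝ) →ₗ.[ℝ] ℝ) (fun f => sInf (A f))
    (by
      intro s hs f
      apply le_antisymm
      · rw [← div_le_iff₀' hs]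
        refine le_csInf (hne f) fun r hr => ?_
        rw [div_le_iff₀' hs]
        exact csInf_le (hbdd _) (hsmul_mem s hs f r hr)
      · refine le_csInf (hne _) fun r hr => ?_
        have := hsmul_mem s⁻¹ (by positivity) _ r hr
        rw [inv_smul_smul₀ hs.ne'] at this
        rw [← le_inv_mul_iff₀ hs]
        exact csInf_le (hbdd _) this)
    (by
      intro f g
      refine le_of_forall_pos_le_add fun ε hε => ?_
      obtain ⟨r, hr, hr'⟩ := exists_lt_of_csInf_lt (hne f)
        (lt_add_of_pos_right (sInf (A f)) (half_pos hε))
      obtain ⟨s, hs, hs'⟩ := exists_lt_of_csInf_lt (hne g)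
        (lt_add_of_pos_right (sInf (A g)) (half_pos hε))
      have : r + s ∈ A (f + g) := by
        obtain ⟨u, t, ht, h, rfl⟩ := hr
        obtain ⟨u', t', ht', h', rfl⟩ := hs
        refine ⟨u + u', t + t', by positivity, fun x hx => ?_, ?_⟩
        · have h1 := h x hx
          have h2 := h' x hx
          simp only [map_add, ContinuousMap.add_apply]
          linarith
        · simp only [ContinuousMap.add_apply]
          rw [integral_add (hint u) (hint u')]
          ring
      have := csInf_le (hbdd _) this
      linarith)
    (by
      rintro ⟨f, hf⟩
      obtain rfl : f = 0 := by simpa using hf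
      refine le_csInf (hne _) fun r hr => ?_
      simpa using hlow 0 r hr)
  have hLA : ∀ f, ∀ r ∈ A f, L f ≤ r := fun f r hr => (hL f).trans (csInf_le (hbdd f) hr)
  have hLle : ∀ u f, (∀ x, f x ≤ meanMap N u x) → L f ≤ ∫ x, u x ∂μ := by
    intro u f h
    refine le_of_forall_pos_le_add fun ε hε => ?_
    -- `t = 0` is not allowed, so `t` is chosen small enough to add at most `ε` to the price.
    have ht : 0 < ε / (D + 1) := by positivity
    refine (hLA f _ ⟨u, ε / (D + 1), ht, fun x _ => ?_, rfl⟩).trans ?_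
    · have : 0 ≤ ε / (D + 1) * (c x).toReal := by positivity
      linarith [h x]
    · have : ε / (D + 1) * D ≤ ε := by
        rw [div_mul_eq_mul_div, div_le_iff₀ (by positivity)]
        nlinarith
      linarith
  have hLmean : ∀ u, L (meanMap N u) = ∫ x, u x ∂μ := by
    intro u
    refine le_antisymm (hLle u _ fun x => le_rfl) ?_
    have := hLle (-u) (-meanMap N u) fun x => by simp
    simp only [map_neg, ContinuousMap.neg_apply, integral_neg] at this
    linarith
  have hLc : ∀ f, (∀ x, ENNReal.ofReal (f x) ≤ c x) → L f ≤ D := by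
    intro f h
    refine hLA f D ⟨0, 1, one_pos, fun x hx => ?_, by simp⟩
    have := (ENNReal.ofReal_le_iff_le_toReal hx).1 (h x)
    simpa using this
  obtain ⟨P, hPfin, hP⟩ := exists_measure_integral_eq L fun f hf => by
    have := hLle 0 (-f) fun x => by simpa using hf x
    simpa using this
  have hprob : IsProbabilityMeasure P := by
    have h := hP (meanMap N (ContinuousMap.const X 1))
    rw [hLmean, meanMap_const hN] at h
    simp only [ContinuousMap.const_apply, integral_const, smul_eq_mul, mul_one] at h
    rw [probReal_univ (μ := μ)] at h
    refine ⟨?_⟩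
    rwa [measureReal_def, ENNReal.toReal_eq_one_iff] at h
  refine ⟨P, hprob, fun u => (hP _).trans (hLmean u), ?_⟩
  -- `L` only sees continuous functions; the bound for `c` follows by monotone convergence from
  -- continuous functions below it.
  obtain ⟨f, hfmono, hf0, hfc⟩ := exists_monotone_continuous_iSup_eq hc
  simp_rw [← hfc]
  rw [lintegral_iSup (f := fun n x => ENNReal.ofReal (f n x))
    (fun n => (f n).continuous.measurable.ennreal_ofReal)
    (fun n m h x => ENNReal.ofReal_le_ofReal (hfmono h x))]
  refine iSup_le fun n => ?_
  rw [← ofReal_integral_eq_lintegral_ofReal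
    (integrable_continuousMap P (f n))
    (Eventually.of_forall (hf0 n)), hP]
  exact ENNReal.ofReal_le_ofReal (hLc _ fun x =>
    (le_iSup (fun n => ENNReal.ofReal (f n x)) n).trans_eq (hfc x))

/-! ### Semicontinuity of the cost on the compactification -/

/-- `X` is homeomorphic to the unit sphere of `ℝ^{d+1}`. -/
instance instSecondCountableTopologyCompEu (d : ℕ) : SecondCountableTopology (CompEu d) :=
  (onePointEquivSphereOfFinrankEq (ι := Fin (d + 1)) (V := Eu d)
    (by simp)).secondCountableTopology

theorem compInvDist_coe {d : ℕ} (a b : Eu d) :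
    compInvDist (a : CompEu d) (b : CompEu d) = (edist a b)⁻¹ := rfl

theorem compInvDist_infty_left {d : ℕ} (b : CompEu d) :
    compInvDist (OnePoint.infty : CompEu d) b = 0 := by
  induction b using OnePoint.rec <;> rfl

theorem compInvDist_infty_right {d : ℕ} (a : CompEu d) :
    compInvDist a (OnePoint.infty : CompEu d) = 0 := by
  induction a using OnePoint.rec <;> rfl

theorem compCoulombCost_coe {d N : ℕ} (x : Fin N → Eu d) :
    compCoulombCost (fun i => (x i : CompEu d)) = coulombCost x := rfl

theorem continuousAt_compInvDist_coe {d : ℕ} (a b : Eu d) :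
    ContinuousAt (fun p : CompEu d × CompEu d => compInvDist p.1 p.2) (a, b) := by
  have he := (OnePoint.isOpenEmbedding_coe (X := Eu d)).prodMap
    (OnePoint.isOpenEmbedding_coe (X := Eu d))
  refine (he.continuousAt_iff (x := (a, b))).1 ?_
  have : Continuous fun p : Eu d × Eu d => (edist p.1 p.2)⁻¹ :=
    (continuous_fst.edist continuous_snd).inv
  exact this.continuousAt

/-- At a pair containing `ω` the value is 0, the minimum, so there is nothing to check; at finite
pairs there is continuity. -/
theorem lowerSemicontinuous_compInvDist {d : ℕ} :
    LowerSemicontinuous fun p : CompEu d × CompEu d => compInvDist p.1 p.2 := by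
  rintro ⟨a, b⟩
  induction a using OnePoint.rec with
  | infty => intro y hy; simp [compInvDist_infty_left] at hy
  | coe a =>
    induction b using OnePoint.rec with
    | infty => intro y hy; simp [compInvDist_infty_right] at hy
    | coe b => exact (continuousAt_compInvDist_coe a b).lowerSemicontinuousAt

theorem lowerSemicontinuous_compCoulombCost {d N : ℕ} :
    LowerSemicontinuous (compCoulombCost : (Fin N → CompEu d) → ℝ≥0∞) :=
  lowerSemicontinuous_sum fun i _ => lowerSemicontinuous_sum fun j _ =>
    LowerSemicontinuous.comp (g := fun x : Fin N → CompEu d => (x i, x j))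
      lowerSemicontinuous_compInvDist ((continuous_apply i).prodMk (continuous_apply j))

/-- The neighbourhoods of `a`, except that the point at infinity is treated as isolated. -/
def isolatedNhds {d : ℕ} (a : CompEu d) : Filter (CompEu d) :=
  𝓝[{y | a = OnePoint.infty → y = OnePoint.infty}] a

theorem isolatedNhds_infty {d : ℕ} :
    isolatedNhds (OnePoint.infty : CompEu d) = pure OnePoint.infty := by
  simp [isolatedNhds]

theorem isolatedNhds_coe {d : ℕ} (a : Eu d) :
    isolatedNhds (a : CompEu d) = 𝓝 (a : CompEu d) := by
  simp [isolatedNhds]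

theorem isolatedNhds_le {d : ℕ} (a : CompEu d) : isolatedNhds a ≤ 𝓝 a := nhdsWithin_le_nhds

/-- Full continuity, which fails at `(ω, ω)` because finite points near `ω` may be arbitrarily close
to each other, is restored by isolating `ω`. -/
theorem tendsto_compInvDist {d : ℕ} (a b : CompEu d) :
    Tendsto (fun p : CompEu d × CompEu d => compInvDist p.1 p.2)
      (isolatedNhds a ×ˢ isolatedNhds b) (𝓝 (compInvDist a b)) := by
  induction a using OnePoint.rec with
  | infty =>
    rw [isolatedNhds_infty, pure_prod]
    simpa [tendsto_map'_iff, Function.comp_def, compInvDist_infty_left] using tendsto_const_nhds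
  | coe a =>
    induction b using OnePoint.rec with
    | infty =>
      rw [isolatedNhds_infty, prod_pure]
      simpa [tendsto_map'_iff, Function.comp_def, compInvDist_infty_right] using
        tendsto_const_nhds
    | coe b =>
      rw [isolatedNhds_coe, isolatedNhds_coe, ← nhds_prod_eq]
      exact continuousAt_compInvDist_coe a b

theorem tendsto_compCoulombCost {d N : ℕ} (x : Fin N → CompEu d) :
    Tendsto compCoulombCost (Filter.pi fun i => isolatedNhds (x i)) (𝓝 (compCoulombCost x)) :=
  tendsto_finsetSum _ fun i _ => tendsto_finsetSum _ fun j _ =>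
    (tendsto_compInvDist (x i) (x j)).comp
      ((tendsto_eval_pi (fun i => isolatedNhds (x i)) i).prodMk
        (tendsto_eval_pi (fun i => isolatedNhds (x i)) j))

/-! ### Permutation invariance of the cost and integration against `ρ̃` -/

/-- The right-hand side does not refer to the order on indices, so permutation invariance of the
cost can be read off from it. -/
theorem two_mul_sum_sum_Ioi {N : ℕ} (k : Fin N → Fin N → ℝ≥0∞) (hk : ∀ i j, k i j = k j i) :
    2 * ∑ i, ∑ j ∈ Finset.Ioi i, k i j = ∑ i, ∑ j, if i ≠ j then k i j else 0 := by
  have h1 : ∑ i, ∑ j ∈ Finset.Ioi i, k i j = ∑ i, ∑ j, if i < j then k i j else 0 := by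
    refine Finset.sum_congr rfl fun i _ => ?_
    rw [← Finset.sum_filter]
    congr 1
    ext; simp
  have h2 : ∑ i, ∑ j ∈ Finset.Ioi i, k i j = ∑ i, ∑ j, if j < i then k i j else 0 := by
    rw [h1, Finset.sum_comm]
    simp_rw [hk]
  rw [two_mul]
  nth_rewrite 1 [h1]
  rw [h2, ← Finset.sum_add_distrib]
  refine Finset.sum_congr rfl fun i _ => ?_
  rw [← Finset.sum_add_distrib]
  refine Finset.sum_congr rfl fun j _ => ?_
  rcases lt_trichotomy i j with h | h | h
  · simp [h, h.ne, h.not_gt]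
  · simp [h]
  · simp [h, h.ne', h.not_gt]

theorem coulombCost_perm {d N : ℕ} (σ : Equiv.Perm (Fin N)) (x : Fin N → Eu d) :
    coulombCost (fun i => x (σ i)) = coulombCost x := by
  have h2 : (2 : ℝ≥0∞) ≠ 0 := by simp
  rw [← ENNReal.mul_right_inj h2 (by simp)]
  unfold coulombCost
  rw [two_mul_sum_sum_Ioi (fun i j => (edist (x i) (x j))⁻¹) (fun i j => by rw [edist_comm]),
    two_mul_sum_sum_Ioi (fun i j => (edist (x (σ i)) (x (σ j)))⁻¹)
      (fun i j => by rw [edist_comm]),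
    ← Equiv.sum_comp σ (fun i => ∑ j, if i ≠ j then (edist (x i) (x j))⁻¹ else 0)]
  refine Finset.sum_congr rfl fun i _ => ?_
  rw [← Equiv.sum_comp σ (fun j => if σ i ≠ j then (edist (x (σ i)) (x j))⁻¹ else 0)]
  simp

theorem measurable_coulombCost {d N : ℕ} : Measurable (coulombCost : (Fin N → Eu d) → ℝ≥0∞) :=
  Finset.measurable_fun_sum _ fun i _ => Finset.measurable_fun_sum _ fun j _ =>
    ((measurable_pi_apply i).edist (measurable_pi_apply j)).inv

theorem isProbabilityMeasure_compMeasure {d : ℕ} {ρ : Measure (Eu d)} (hρ : ρ Set.univ ≤ 1) :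
    IsProbabilityMeasure (compMeasure ρ) := by
  refine ⟨?_⟩
  have hm : Measurable fun x : Eu d => (x : CompEu d) := OnePoint.continuous_coe.measurable
  simp [compMeasure, Measure.map_apply hm MeasurableSet.univ, add_tsub_cancel_of_le hρ]

theorem integral_compMeasure {d : ℕ} {ρ : Measure (Eu d)} (hρ : ρ Set.univ ≤ 1)
    (u : C(CompEu d, ℝ)) :
    ∫ x, u x ∂compMeasure ρ =
      ∫ x, u (x : CompEu d) ∂ρ + (1 - ρ Set.univ).toReal * u OnePoint.infty := by
  have : IsFiniteMeasure ρ := ⟨hρ.trans_lt ENNReal.one_lt_top⟩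
  have hm : Measurable fun x : Eu d => (x : CompEu d) := OnePoint.continuous_coe.measurable
  have hfin : IsFiniteMeasure
      ((1 - ρ Set.univ) • Measure.dirac (OnePoint.infty : CompEu d)) :=
    Measure.smul_finite _ (by simp)
  rw [compMeasure, integral_add_measure (integrable_continuousMap _ u)
    (integrable_continuousMap _ u), integral_smul_measure, integral_dirac,
    integral_map hm.aemeasurable u.continuous.aestronglyMeasurable, smul_eq_mul]

/-! ### Upper bound: moving mass from `ω` to far away points -/

noncomputable section

/-- The point itself at finite distance, and the origin for the point at infinity. -/
def finitePart {d : ℕ} (a : CompEu d) : Eu d := a.elim 0 id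

open scoped Classical in
/-- Replace the coordinates at infinity of `x` by distinct points on the ray through `e`, which
are at distance at least `n + 1` from each other and from the other coordinates of `x`. -/
def pushFar {d N : ℕ} (e : Eu d) (n : ℕ) (x : Fin N → CompEu d) (i : Fin N) : Eu d :=
  if x i = OnePoint.infty then
    (((n : ℝ) + 1) * ((i : ℝ) + 1) + ∑ j, ‖finitePart (x j)‖) • e
  else finitePart (x i)

end

theorem finitePart_coe {d : ℕ} (a : Eu d) : finitePart (a : CompEu d) = a := rfl

theorem measurable_finitePart {d : ℕ} : Measurable (finitePart : CompEu d → Eu d) := by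
  refine measurable_of_measurable_on_compl_singleton OnePoint.infty
    (continuousOn_iff_continuous_domRestrict.1 ?_).measurable
  refine continuousOn_of_forall_continuousAt fun a ha => ?_
  induction a using OnePoint.rec with
  | infty => exact absurd rfl ha
  | coe a => exact OnePoint.continuousAt_coe.2 continuousAt_id

theorem measurable_pushFar {d N : ℕ} (e : Eu d) (n : ℕ) (i : Fin N) :
    Measurable fun x : Fin N → CompEu d => pushFar e n x i := by
  classical
  refine Measurable.ite ?_ ?_ (measurable_finitePart.comp (measurable_pi_apply i))
  · exact measurable_pi_apply i (measurableSet_singleton _)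
  · refine Measurable.smul_const ?_ e
    refine measurable_const.add (Finset.measurable_fun_sum _ fun j _ => ?_)
    exact (measurable_finitePart.comp (measurable_pi_apply j)).norm

theorem pushFar_of_eq_coe {d N : ℕ} (e : Eu d) (n : ℕ) {x : Fin N → CompEu d} {i : Fin N}
    {a : Eu d} (h : x i = a) : pushFar e n x i = a := by
  simp [pushFar, h, finitePart_coe]

theorem le_norm_pushFar {d N : ℕ} {e : Eu d} (he : ‖e‖ = 1) (n : ℕ) {x : Fin N → CompEu d}
    {i : Fin N} (h : x i = OnePoint.infty) :
    (n : ℝ) + 1 + ∑ j, ‖finitePart (x j)‖ ≤ ‖pushFar e n x i‖ := by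
  have hs : 0 ≤ ∑ j, ‖finitePart (x j)‖ := Finset.sum_nonneg fun _ _ => norm_nonneg _
  have h0 : 0 ≤ ((n : ℝ) + 1) * ((i : ℝ) + 1) + ∑ j, ‖finitePart (x j)‖ :=
    add_nonneg (by positivity) hs
  rw [pushFar, if_pos h, norm_smul, he, mul_one, Real.norm_of_nonneg h0]
  have : (n : ℝ) + 1 ≤ ((n : ℝ) + 1) * ((i : ℝ) + 1) :=
    le_mul_of_one_le_right (by positivity) (by simp)
  linarith

theorem le_dist_pushFar_of_left {d N : ℕ} {e : Eu d} (he : ‖e‖ = 1) (n : ℕ)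
    {x : Fin N → CompEu d} {i j : Fin N} (hij : i ≠ j) (h : x i = OnePoint.infty) :
    (n : ℝ) + 1 ≤ dist (pushFar e n x i) (pushFar e n x j) := by
  rcases eq_or_ne (x j) OnePoint.infty with hj | hj
  · rw [pushFar, pushFar, if_pos h, if_pos hj, dist_eq_norm, ← sub_smul, norm_smul, he, mul_one,
      add_sub_add_right_eq_sub, ← mul_sub, Real.norm_eq_abs, abs_mul,
      abs_of_nonneg (by positivity)]
    refine le_mul_of_one_le_right (by positivity) ?_
    rw [add_sub_add_right_eq_sub]
    have : (1 : ℤ) ≤ |(i : ℤ) - (j : ℤ)| :=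
      Int.one_le_abs (sub_ne_zero.2 fun h => hij (Fin.ext (by exact_mod_cast h)))
    exact_mod_cast this
  · obtain ⟨a, ha⟩ := OnePoint.ne_infty_iff_exists.1 hj
    have h1 := le_norm_pushFar he n h
    -- The sum of norms in `pushFar` absorbs `‖a‖`, so the reverse triangle inequality leaves `n +
    -- 1`.
    have h2 : ‖a‖ ≤ ∑ j, ‖finitePart (x j)‖ := by
      refine le_trans ?_ (Finset.single_le_sum (f := fun j => ‖finitePart (x j)‖)
        (fun _ _ => norm_nonneg _) (Finset.mem_univ j))
      simp [← ha, finitePart_coe]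
    rw [pushFar_of_eq_coe e n ha.symm, dist_eq_norm]
    have h3 := norm_sub_norm_le (pushFar e n x i) a
    linarith

theorem inv_edist_pushFar_le {d N : ℕ} {e : Eu d} (he : ‖e‖ = 1) (n : ℕ)
    (x : Fin N → CompEu d) {i j : Fin N} (hij : i ≠ j) :
    (edist (pushFar e n x i) (pushFar e n x j))⁻¹ ≤
      compInvDist (x i) (x j) + ((n : ℝ≥0∞) + 1)⁻¹ := by
  have key : ∀ y z : Eu d, (n : ℝ) + 1 ≤ dist y z → (edist y z)⁻¹ ≤ ((n : ℝ≥0∞) + 1)⁻¹ := by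
    intro y z h
    refine ENNReal.inv_le_inv.2 ?_
    rw [edist_dist]
    refine le_trans (le_of_eq ?_) (ENNReal.ofReal_le_ofReal h)
    rw [ENNReal.ofReal_add (by positivity) zero_le_one]
    simp
  rcases eq_or_ne (x i) OnePoint.infty with hi | hi
  · exact (key _ _ (le_dist_pushFar_of_left he n hij hi)).trans le_add_self
  rcases eq_or_ne (x j) OnePoint.infty with hj | hj
  · rw [edist_comm]
    exact (key _ _ (le_dist_pushFar_of_left he n hij.symm hj)).trans le_add_self
  obtain ⟨a, ha⟩ := OnePoint.ne_infty_iff_exists.1 hi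
  obtain ⟨b, hb⟩ := OnePoint.ne_infty_iff_exists.1 hj
  rw [pushFar_of_eq_coe e n ha.symm, pushFar_of_eq_coe e n hb.symm, ← ha, ← hb, compInvDist_coe]
  exact le_self_add

theorem coulombCost_pushFar_le {d N : ℕ} {e : Eu d} (he : ‖e‖ = 1) (n : ℕ)
    (x : Fin N → CompEu d) :
    coulombCost (pushFar e n x) ≤
      compCoulombCost x + (N : ℝ≥0∞) * (N * ((n : ℝ≥0∞) + 1)⁻¹) := by
  have h1 : ∀ i : Fin N, ∑ j ∈ Finset.Ioi i, (edist (pushFar e n x i) (pushFar e n x j))⁻¹ ≤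
      ∑ j ∈ Finset.Ioi i, compInvDist (x i) (x j) + N * ((n : ℝ≥0∞) + 1)⁻¹ := by
    intro i
    refine (Finset.sum_le_sum fun j hj =>
      inv_edist_pushFar_le he n x (Finset.mem_Ioi.1 hj).ne).trans ?_
    rw [Finset.sum_add_distrib, Finset.sum_const, nsmul_eq_mul]
    gcongr
    simpa using Finset.card_le_univ (Finset.Ioi i)
  refine (Finset.sum_le_sum fun i _ => h1 i).trans ?_
  rw [Finset.sum_add_distrib, Finset.sum_const, nsmul_eq_mul]
  simp [compCoulombCost]

theorem natCast_inv_mul_cancel {N : ℕ} (hN : 1 ≤ N) : (N : ℝ≥0∞)⁻¹ * N = 1 :=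
  ENNReal.inv_mul_cancel (by simpa using (by omega : N ≠ 0)) (by simp)

/-- Averaging a law on `(ℝ^d)^N` over the cyclic shifts of the coordinates yields a plan. -/
theorem transportCost_mean_marginals_le {d N : ℕ} (hN : 1 ≤ N) (Q : Measure (Fin N → Eu d))
    [IsProbabilityMeasure Q] :
    transportCost N ((N : ℝ≥0∞)⁻¹ • ∑ j, Q.map (fun x => x j)) ≤ ∫⁻ x, coulombCost x ∂Q := by
  have : NeZero N := ⟨by omega⟩
  let S : Fin N → (Fin N → Eu d) → Fin N → Eu d := fun s x i => x (i + s)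
  have hS : ∀ s, Measurable (S s) := fun s =>
    measurable_pi_lambda _ fun i => measurable_pi_apply (i + s)
  let R : Measure (Fin N → Eu d) := (N : ℝ≥0∞)⁻¹ • ∑ s, Q.map (S s)
  have hR : IsPlan ((N : ℝ≥0∞)⁻¹ • ∑ j, Q.map (fun x => x j)) R := by
    refine ⟨⟨?_⟩, fun i => ?_⟩
    · simp [R, Measure.map_apply (hS _), natCast_inv_mul_cancel hN]
    · rw [Measure.map_smul]
      congr 1
      rw [← Measure.mapₗ_apply_of_measurable (measurable_pi_apply i), map_sum]
      simp_rw [Measure.mapₗ_apply_of_measurable (measurable_pi_apply i)]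
      simp_rw [Measure.map_map (measurable_pi_apply i) (hS _)]
      -- For fixed `i`, the index `i + s` runs once through all coordinates as `s` varies.
      exact Equiv.sum_comp (Equiv.addLeft i) (fun j => Q.map (fun x : Fin N → Eu d => x j))
  refine (iInf₂_le R hR).trans (le_of_eq ?_)
  rw [lintegral_smul_measure, lintegral_finsetSum_measure]
  have : ∀ s, ∫⁻ x, coulombCost x ∂(Q.map (S s)) = ∫⁻ x, coulombCost x ∂Q := by
    intro s
    rw [lintegral_map measurable_coulombCost (hS s)]
    exact lintegral_congr fun x => coulombCost_perm (Equiv.addRight s) x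
  simp [this, ← mul_assoc, natCast_inv_mul_cancel hN]

theorem tendsto_pushFar {d N : ℕ} {e : Eu d} (he : ‖e‖ = 1) (f : C₀(Eu d, ℝ))
    (x : Fin N → CompEu d) (i : Fin N) :
    Tendsto (fun n => f (pushFar e n x i)) atTop (𝓝 ((x i).elim 0 f)) := by
  rcases eq_or_ne (x i) OnePoint.infty with hi | hi
  · rw [hi]
    refine (zero_at_infty f).comp ?_
    rw [← Metric.cobounded_eq_cocompact, ← tendsto_norm_atTop_iff_cobounded]
    refine tendsto_atTop_mono (fun n => ?_) tendsto_natCast_atTop_atTop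
    have := le_norm_pushFar he n hi
    have hs : 0 ≤ ∑ j, ‖finitePart (x j)‖ := Finset.sum_nonneg fun _ _ => norm_nonneg _
    linarith
  · obtain ⟨a, ha⟩ := OnePoint.ne_infty_iff_exists.1 hi
    simp_rw [pushFar_of_eq_coe e _ ha.symm, ← ha]
    exact tendsto_const_nhds

/-- The relaxed cost is at most the cost of any law on `X^N` whose marginals average to `ρ̃`. -/
theorem relaxedCost_le {d N : ℕ} (hd : 1 ≤ d) (hN : 1 ≤ N) {ρ : Measure (Eu d)}
    (hρ : ρ Set.univ ≤ 1) (P : Measure (Fin N → CompEu d)) [IsProbabilityMeasure P]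
    (hP : ∀ u : C(CompEu d, ℝ), ∫ x, meanMap N u x ∂P = ∫ x, u x ∂compMeasure ρ) :
    relaxedCost N ρ ≤ ∫⁻ x, compCoulombCost x ∂P := by
  obtain ⟨e, he⟩ : ∃ e : Eu d, ‖e‖ = 1 :=
    ⟨EuclideanSpace.single (⟨0, hd⟩ : Fin d) 1, by simp⟩
  have hF : ∀ n, Measurable (pushFar e n : (Fin N → CompEu d) → Fin N → Eu d) := fun n =>
    measurable_pi_lambda _ fun i => measurable_pushFar e n i
  have hQ : ∀ n, IsProbabilityMeasure (P.map (pushFar e n)) := fun n =>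
    Measure.isProbabilityMeasure_map (hF n).aemeasurable
  let σ : ℕ → Measure (Eu d) := fun n =>
    (N : ℝ≥0∞)⁻¹ • ∑ j, (P.map (pushFar e n)).map (fun x => x j)
  have hmap : ∀ n j, (P.map (pushFar e n)).map (fun x => x j) =
      P.map (fun x => pushFar e n x j) := fun n j =>
    Measure.map_map (measurable_pi_apply j) (hF n)
  have hσ : ∀ n, IsProbabilityMeasure (σ n) := by
    refine fun n => ⟨?_⟩
    simp [σ, hmap, Measure.map_apply (measurable_pushFar e n _), natCast_inv_mul_cancel hN]
  let τ : ℕ → ProbabilityMeasure (Eu d) := fun n => ⟨σ n, hσ n⟩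
  have hweak : WeakStarTendsto τ ρ := by
    intro f
    have hf : Measurable f := f.continuous.measurable
    -- Extended by 0 at `ω`, the test function is continuous on `X` and does not see the mass of
    -- `ρ̃` at `ω`.
    let u : C(CompEu d, ℝ) := OnePoint.continuousMapMk ⟨f, f.continuous⟩ 0 (by
      rw [coclosedCompact_eq_cocompact]
      exact zero_at_infty f)
    have h1 : ∫ x, f x ∂ρ = ∫ x, meanMap N u x ∂P := by
      rw [hP, integral_compMeasure hρ]
      have : u OnePoint.infty = 0 := rfl
      rw [this, mul_zero, add_zero]
      rfl
    have h2 : ∀ n, ∫ x, f x ∂(σ n) =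
        ∫ x, (1 / (N : ℝ)) * ∑ j, f (pushFar e n x j) ∂P := by
      intro n
      have h3 : ∀ j, ∫ x, f x ∂((P.map (pushFar e n)).map (fun x => x j)) =
          ∫ x, f (pushFar e n x j) ∂P := fun j => by
        rw [hmap, integral_map (measurable_pushFar e n j).aemeasurable hf.aestronglyMeasurable]
      have h4 : ∀ j, Integrable (fun x => f (pushFar e n x j)) P := fun j =>
        (f.toBCF.integrable (P.map fun x => pushFar e n x j)).comp_measurable
          (measurable_pushFar e n j)
      have h5 : ∀ j, IsFiniteMeasure ((P.map (pushFar e n)).map (fun x => x j)) := fun j => by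
        rw [hmap]; infer_instance
      rw [integral_smul_measure,
        integral_finsetSum_measure (f := f) fun j _ => f.toBCF.integrable _,
        integral_const_mul, integral_finsetSum _ fun j _ => h4 j]
      simp [← h3]
    simp only [τ, ProbabilityMeasure.coe_mk, h2, h1]
    refine tendsto_integral_of_dominated_convergence
      (fun _ => (1 / (N : ℝ)) * ∑ j : Fin N, ‖f.toBCF‖) (fun n => ?_) (integrable_const _) (fun n => ?_) ?_
    · refine Measurable.aestronglyMeasurable ?_
      refine measurable_const.mul (Finset.measurable_fun_sum _ fun j _ => ?_)
      exact hf.comp (measurable_pushFar e n j)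
    · refine Eventually.of_forall fun x => ?_
      rw [norm_mul, Real.norm_of_nonneg (by positivity)]
      refine mul_le_mul_of_nonneg_left ?_ (by positivity)
      exact (norm_sum_le _ _).trans
        (Finset.sum_le_sum fun j _ => f.toBCF.norm_coe_le_norm _)
    · refine Eventually.of_forall fun x => ?_
      exact (tendsto_finsetSum _ fun j _ => tendsto_pushFar he f x j).const_mul _
  refine iInf₂_le_of_le τ hweak ?_
  have hle : ∀ n, transportCost N (σ n) ≤
      ∫⁻ x, compCoulombCost x ∂P + (N : ℝ≥0∞) * (N * ((n : ℝ≥0∞) + 1)⁻¹) := by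
    intro n
    refine (transportCost_mean_marginals_le hN _).trans ?_
    rw [lintegral_map measurable_coulombCost (hF n)]
    refine (lintegral_mono fun x => coulombCost_pushFar_le he n x).trans (le_of_eq ?_)
    rw [lintegral_add_right _ measurable_const]
    simp
  have hlim : Tendsto (fun n : ℕ => ∫⁻ x, compCoulombCost x ∂P +
      (N : ℝ≥0∞) * (N * ((n : ℝ≥0∞) + 1)⁻¹)) atTop (𝓝 (∫⁻ x, compCoulombCost x ∂P)) := by
    have h0 : Tendsto (fun n : ℕ => ((n : ℝ≥0∞) + 1)⁻¹) atTop (𝓝 0) := by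
      have := (tendsto_add_atTop_iff_nat 1).2 ENNReal.tendsto_inv_nat_nhds_zero
      simpa using this
    have h1 := ENNReal.Tendsto.const_mul (a := (N : ℝ≥0∞))
      (ENNReal.Tendsto.const_mul (a := (N : ℝ≥0∞)) h0 (by simp)) (by simp)
    simpa using h1.const_add (∫⁻ x, compCoulombCost x ∂P)
  exact (liminf_le_liminf (Eventually.of_forall hle)).trans_eq hlim.liminf_eq

/-! ### Lower bound by continuous potentials -/

theorem ofReal_integral_le_lintegral_ofReal {α : Type*} [MeasurableSpace α] {μ : Measure α}
    {f : α → ℝ} (hf : Integrable f μ) :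
    ENNReal.ofReal (∫ x, f x ∂μ) ≤ ∫⁻ x, ENNReal.ofReal (f x) ∂μ := by
  rw [integral_eq_lintegral_pos_part_sub_lintegral_neg_part hf]
  exact (ENNReal.ofReal_le_ofReal (sub_le_self _ ENNReal.toReal_nonneg)).trans
    ENNReal.ofReal_toReal_le

theorem extIntegral_eq_integral {α : Type*} [MeasurableSpace α] {μ : Measure α}
    {f : α → ℝ} (hf : Integrable f μ) : extIntegral μ f = ((∫ x, f x ∂μ : ℝ) : EReal) := by
  have h1 : ∫⁻ x, ENNReal.ofReal (f x) ∂μ ≠ ⊤ := hf.lintegral_lt_top.ne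
  have h2 : ∫⁻ x, ENNReal.ofReal (-f x) ∂μ ≠ ⊤ := hf.neg.lintegral_lt_top.ne
  rw [integral_eq_lintegral_pos_part_sub_lintegral_neg_part hf, EReal.coe_sub,
    EReal.coe_ennreal_toReal h1, EReal.coe_ennreal_toReal h2, extIntegral]

/-- Functions satisfying the dual constraint everywhere bound the transport cost from below. -/
theorem ofReal_integral_le_transportCost {d N : ℕ} (hN : 1 ≤ N) (σ : Measure (Eu d))
    [IsProbabilityMeasure σ] (u : C(CompEu d, ℝ))
    (hu : ∀ x : Fin N → CompEu d, compCoulombCost x ≠ ⊤ →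
      meanMap N u x ≤ (compCoulombCost x).toReal) :
    ENNReal.ofReal (∫ x, u (x : CompEu d) ∂σ) ≤ transportCost N σ := by
  have hcont : Continuous fun x : Eu d => u (x : CompEu d) :=
    u.continuous.comp OnePoint.continuous_coe
  refine le_iInf₂ fun P hP => ?_
  have := hP.1
  have hcoe : Continuous fun (x : Fin N → Eu d) (i : Fin N) => (x i : CompEu d) :=
    continuous_pi fun i => OnePoint.continuous_coe.comp (continuous_apply i)
  have hint : ∀ i : Fin N, Integrable (fun x : Fin N → Eu d => u (x i : CompEu d)) P := fun i =>
    (BoundedContinuousFunction.ofNormedAddCommGroup (fun x : Fin N → Eu d => u (x i : CompEu d))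
      (hcont.comp (continuous_apply i)) ‖u‖ (fun x => u.norm_coe_le_norm _)).integrable P
  have hmean : ∫ x, u (x : CompEu d) ∂σ =
      ∫ x, meanMap N u (fun i => (x i : CompEu d)) ∂P := by
    simp only [meanMap_apply]
    rw [integral_const_mul, integral_finsetSum _ fun i _ => hint i]
    have h1 : ∀ i : Fin N, ∫ x, u (x i : CompEu d) ∂P = ∫ x, u (x : CompEu d) ∂σ := by
      intro i
      rw [← hP.2 i, integral_map (measurable_pi_apply i).aemeasurable
        hcont.aestronglyMeasurable]
    have hN' : (N : ℝ) ≠ 0 := by positivity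
    simp [h1, hN']
  have hint' : Integrable (fun x => meanMap N u (fun i => (x i : CompEu d))) P := by
    simp only [meanMap_apply]
    exact (integrable_finsetSum _ fun i _ => hint i).const_mul _
  rw [hmean]
  refine (ofReal_integral_le_lintegral_ofReal hint').trans (lintegral_mono fun x => ?_)
  rw [← compCoulombCost_coe]
  by_cases hx : compCoulombCost (fun i => (x i : CompEu d)) = ⊤
  · rw [hx]; exact le_top
  · exact (ENNReal.ofReal_le_iff_le_toReal hx).2 (hu _ hx)

/-- The function `u - u(ω)` vanishes at infinity, and the constant `u(ω)` has the same integral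
against every probability. Hence `∫ u dρ_n → ∫ u dρ̃`, and the bound for each `C(ρ_n)` passes to the
liminf. -/
theorem ofReal_integral_le_relaxedCost {d N : ℕ} (hN : 1 ≤ N) {ρ : Measure (Eu d)}
    (hρ : ρ Set.univ ≤ 1) (u : C(CompEu d, ℝ))
    (hu : ∀ x : Fin N → CompEu d, compCoulombCost x ≠ ⊤ →
      meanMap N u x ≤ (compCoulombCost x).toReal) :
    ENNReal.ofReal (∫ x, u x ∂compMeasure ρ) ≤ relaxedCost N ρ := by
  refine le_iInf₂ fun σ hσ => ?_
  have hfin : IsFiniteMeasure ρ := ⟨hρ.trans_lt ENNReal.one_lt_top⟩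
  let f : C₀(Eu d, ℝ) :=
    { toFun := fun x => u (x : CompEu d) - u OnePoint.infty
      continuous_toFun := (u.continuous.comp OnePoint.continuous_coe).sub continuous_const
      zero_at_infty' := by
        have h := ((u.continuous.tendsto OnePoint.infty).comp
          OnePoint.tendsto_coe_infty).sub_const (u OnePoint.infty)
        rw [coclosedCompact_eq_cocompact, sub_self] at h
        exact h }
  have hf : ∀ (ν : Measure (Eu d)) [IsFiniteMeasure ν], ∫ x, u (x : CompEu d) ∂ν =
      ∫ x, f x ∂ν + (ν Set.univ).toReal * u OnePoint.infty := by
    intro ν _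
    have h1 : ∀ x : Eu d, u (x : CompEu d) = f x + u OnePoint.infty := fun x =>
      (sub_add_cancel _ _).symm
    simp_rw [h1]
    rw [integral_add (f := f) (f.toBCF.integrable ν) (integrable_const _)]
    simp [measureReal_def]
  have hlim : Tendsto (fun n => ∫ x, u (x : CompEu d) ∂(σ n : Measure (Eu d))) atTop
      (𝓝 (∫ x, u x ∂compMeasure ρ)) := by
    have h1 : ∫ x, u x ∂compMeasure ρ = ∫ x, f x ∂ρ + u OnePoint.infty := by
      rw [integral_compMeasure hρ, hf, ENNReal.toReal_sub_of_le hρ (by simp)]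
      simp only [ENNReal.toReal_one]
      ring
    simp_rw [h1, hf, measure_univ, ENNReal.toReal_one, one_mul]
    exact (hσ f).add_const _
  rw [← ((ENNReal.continuous_ofReal.tendsto _).comp hlim).liminf_eq]
  exact liminf_le_liminf (Eventually.of_forall fun n =>
    ofReal_integral_le_transportCost hN _ u hu)

/-! ### From almost everywhere to the support, and weak duality -/

/-- The points all of whose (isolated) neighbourhoods have positive measure. -/
def isolatedSupport {d : ℕ} (μ : Measure (CompEu d)) : Set (CompEu d) :=
  {a | ∀ V ∈ isolatedNhds a, 0 < μ V}

/-- A finite point outside lies off the topological support, whose complement is null; `ω` is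
outside only if it carries no mass. -/
theorem isolatedSupport_mem_ae {d : ℕ} (μ : Measure (CompEu d)) : isolatedSupport μ ∈ ae μ := by
  have hsub : (isolatedSupport μ)ᶜ ⊆
      μ.supportᶜ ∪ {a | a = OnePoint.infty ∧ μ {OnePoint.infty} = 0} := by
    intro a ha
    simp only [isolatedSupport, Set.mem_compl_iff, Set.mem_ofPred_eq, not_forall, not_lt,
      nonpos_iff_eq_zero] at ha
    obtain ⟨V, hV, hV0⟩ := ha
    induction a using OnePoint.rec with
    | infty =>
      rw [isolatedNhds_infty] at hV
      exact Or.inr ⟨rfl, measure_mono_null (Set.singleton_subset_iff.2 hV) hV0⟩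
    | coe a =>
      rw [isolatedNhds_coe] at hV
      exact Or.inl (Measure.notMem_support_iff_exists.2 ⟨V, hV, hV0⟩)
  refine measure_mono_null hsub (measure_union_null Measure.measure_compl_support ?_)
  by_cases h : μ {OnePoint.infty} = 0
  · simp [h]
  · simp [h]

/-- For lower semicontinuous `u`, the weak dual constraint holds everywhere on the (isolated)
support. -/
theorem WeakDualAdmissible.le_of_mem_isolatedSupport {d N : ℕ} (hN : 1 ≤ N)
    {μ : Measure (CompEu d)} [IsFiniteMeasure μ] {u : CompEu d → ℝ}
    (hu : LowerSemicontinuous u) (h : WeakDualAdmissible N μ u) {x : Fin N → CompEu d}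
    (hx : ∀ i, x i ∈ isolatedSupport μ) :
    (((1 / (N : ℝ)) * ∑ i, u (x i) : ℝ) : EReal) ≤ ((compCoulombCost x : ℝ≥0∞) : EReal) := by
  have hN' : (0 : ℝ) < N := by exact_mod_cast hN
  by_contra! hlt
  -- A strict violation at `x` persists on a box of isolated neighbourhoods: the cost stays below
  -- `t` by continuity, the mean stays above `t` by lower semicontinuity. The box has positive
  -- product measure, a contradiction.
  obtain ⟨t, hct, htu⟩ := EReal.lt_iff_exists_real_btwn.1 hlt
  have h1 : ∀ᶠ y in Filter.pi fun i => isolatedNhds (x i),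
      ((compCoulombCost y : ℝ≥0∞) : EReal) < t :=
    ((continuous_coe_ennreal_ereal.tendsto _).comp
      (tendsto_compCoulombCost x)).eventually_lt_const hct
  have hlsc : LowerSemicontinuous fun y : Fin N → CompEu d => ∑ i, u (y i) :=
    lowerSemicontinuous_sum fun i _ =>
      LowerSemicontinuous.comp (g := fun y : Fin N → CompEu d => y i) hu (continuous_apply i)
  have hiff : ∀ s : ℝ, (t : EReal) < ((1 / (N : ℝ) * s : ℝ) : EReal) ↔ t * N < s := fun s => by
    rw [EReal.coe_lt_coe_iff, one_div_mul_eq_div, lt_div_iff₀ hN']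
  have h2 : ∀ᶠ y in Filter.pi fun i => isolatedNhds (x i),
      (t : EReal) < (((1 / (N : ℝ)) * ∑ i, u (y i) : ℝ) : EReal) := by
    simp_rw [hiff]
    have hle : (Filter.pi fun i => isolatedNhds (x i)) ≤ 𝓝 x := by
      rw [nhds_pi]
      exact Filter.pi_mono fun i => isolatedNhds_le (x i)
    exact hle (hlsc x _ ((hiff _).1 htu))
  obtain ⟨I, -, V, hV, hVsub⟩ := Filter.mem_pi.1 (h1.and h2)
  have hpos : 0 < Measure.pi (fun _ : Fin N => μ) (Set.univ.pi V) := by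
    rw [Measure.pi_pi]
    exact pos_iff_ne_zero.2 (Finset.prod_ne_zero_iff.2 fun i _ => (hx i _ (hV i)).ne')
  refine hpos.ne' (measure_mono_null (fun y hy => ?_) h)
  obtain ⟨ha, hb⟩ := hVsub (fun i _ => hy i trivial)
  exact not_le.2 (ha.trans hb)

/-- Turns the condition on continuous test functions into an equality of measures, which can be used
with a discontinuous `u` and shows that each marginal is absolutely continuous with respect to `μ`.
-/
theorem mean_marginals_eq {d N : ℕ} (hN : 1 ≤ N) {μ : Measure (CompEu d)} [IsFiniteMeasure μ]
    (P : Measure (Fin N → CompEu d)) [IsProbabilityMeasure P]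
    (hP : ∀ u : C(CompEu d, ℝ), ∫ x, meanMap N u x ∂P = ∫ x, u x ∂μ) :
    (N : ℝ≥0∞)⁻¹ • ∑ j, P.map (fun x => x j) = μ := by
  have hfin : IsFiniteMeasure ((N : ℝ≥0∞)⁻¹ • ∑ j, P.map (fun x => x j)) :=
    Measure.smul_finite _ (by simpa using (by omega : N ≠ 0))
  refine ext_of_forall_integral_eq_of_IsFiniteMeasure fun f => ?_
  have h := hP f.toContinuousMap
  simp only [meanMap_apply] at h
  have hint : ∀ i : Fin N, Integrable (fun x : Fin N → CompEu d => f (x i)) P := fun i =>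
    integrable_continuousMap P ⟨_, f.continuous.comp (continuous_apply i)⟩
  have hi : ∀ i : Fin N, ∫ x, f (x i) ∂P = ∫ x, f x ∂(P.map fun x => x i) := fun i =>
    (integral_map (measurable_pi_apply i).aemeasurable
      f.continuous.measurable.aestronglyMeasurable).symm
  rw [integral_smul_measure, integral_finsetSum_measure (f := f) fun j _ => f.integrable _]
  have h' : (1 / (N : ℝ)) * ∑ i, ∫ x, f (x i) ∂P = ∫ x, f x ∂μ := by
    rw [← integral_finsetSum _ fun i _ => hint i, ← integral_const_mul]
    exact h
  simpa [hi] using h'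

/-- Weak duality between lower semicontinuous functions satisfying the constraint almost
everywhere and laws on `X^N` whose marginals average to `μ`. -/
theorem WeakDualAdmissible.extIntegral_le {d N : ℕ} (hN : 1 ≤ N)
    {μ : Measure (CompEu d)} [IsProbabilityMeasure μ] {u : CompEu d → ℝ}
    (hu : LowerSemicontinuous u) (h : WeakDualAdmissible N μ u)
    (P : Measure (Fin N → CompEu d)) [IsProbabilityMeasure P]
    (hP : ∀ u : C(CompEu d, ℝ), ∫ x, meanMap N u x ∂P = ∫ x, u x ∂μ) :
    extIntegral μ u ≤ ((∫⁻ x, compCoulombCost x ∂P : ℝ≥0∞) : EReal) := by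
  have hN0 : (0 : ℝ) < N := by exact_mod_cast hN
  have hmarg := mean_marginals_eq hN P hP
  have hmeas : Measurable u := hu.measurable
  -- A lower semicontinuous function on a compact space is bounded below; adding `m` allows work
  -- with nonnegative integrals.
  obtain ⟨m, hm0, hm⟩ : ∃ m : ℝ, 0 ≤ m ∧ ∀ a, -m ≤ u a := by
    obtain ⟨b, hb⟩ := (hu.lowerSemicontinuousOn Set.univ).bddBelow_of_isCompact isCompact_univ
    refine ⟨max (-b) 0, le_max_right _ _, fun a => ?_⟩
    have : b ≤ u a := hb ⟨a, trivial, rfl⟩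
    linarith [le_max_left (-b) 0]
  -- Only the marginals of `P` are controlled by `μ`, not `P` by the product measure; this suffices
  -- because the constraint holds at every point of the product of supports.
  have hae : ∀ᵐ x ∂P, ∀ i, x i ∈ isolatedSupport μ := by
    refine ae_all_iff.2 fun i => ?_
    have hac : P.map (fun x => x i) ≪ μ := by
      rw [← hmarg]
      refine Measure.AbsolutelyContinuous.trans (Measure.absolutelyContinuous_of_le ?_)
        (Measure.absolutelyContinuous_smul (by simp))
      exact Finset.single_le_sum (f := fun j => P.map (fun x : Fin N → CompEu d => x j))
        (fun _ _ => Measure.zero_le _) (Finset.mem_univ i)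
    exact ae_of_ae_map (measurable_pi_apply i).aemeasurable
      (hac.ae_le (isolatedSupport_mem_ae μ))
  have hshift : ∫⁻ a, ENNReal.ofReal (u a + m) ∂μ ≤
      ∫⁻ x, compCoulombCost x ∂P + ENNReal.ofReal m := by
    have hvm : Measurable fun a => ENNReal.ofReal (u a + m) :=
      (hmeas.add_const m).ennreal_ofReal
    have h1 : ∫⁻ a, ENNReal.ofReal (u a + m) ∂μ =
        ∫⁻ x, (N : ℝ≥0∞)⁻¹ * ∑ i, ENNReal.ofReal (u (x i) + m) ∂P := by
      have hvi : ∀ i : Fin N, Measurable fun x : Fin N → CompEu d =>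
          ENNReal.ofReal (u (x i) + m) := fun i => hvm.comp (measurable_pi_apply i)
      rw [lintegral_const_mul _ (Finset.measurable_fun_sum _ fun i _ => hvi i),
        lintegral_finsetSum _ fun i _ => hvi i]
      conv_lhs => rw [← hmarg]
      rw [lintegral_smul_measure, lintegral_finsetSum_measure, smul_eq_mul]
      congr 1
      exact Finset.sum_congr rfl fun i _ => lintegral_map hvm (measurable_pi_apply i)
    have h2 : ∫⁻ x, compCoulombCost x ∂P + ENNReal.ofReal m =
        ∫⁻ x, compCoulombCost x + ENNReal.ofReal m ∂P := by
      rw [lintegral_add_right _ measurable_const]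
      simp
    rw [h1, h2]
    refine lintegral_mono_ae ?_
    filter_upwards [hae] with x hx
    have h3 := h.le_of_mem_isolatedSupport hN hu hx
    have h4 : ENNReal.ofReal ((1 / (N : ℝ)) * ∑ i, u (x i)) ≤ compCoulombCost x := by
      rw [← EReal.coe_ennreal_le_coe_ennreal_iff, EReal.coe_ennreal_ofReal]
      exact max_le h3 (EReal.coe_ennreal_nonneg _)
    have h5 : (N : ℝ≥0∞)⁻¹ * ∑ i, ENNReal.ofReal (u (x i) + m) =
        ENNReal.ofReal ((1 / (N : ℝ)) * ∑ i, u (x i) + m) := by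
      rw [← ENNReal.ofReal_sum_of_nonneg fun i _ => by linarith [hm (x i)],
        ← ENNReal.ofReal_natCast, ← ENNReal.ofReal_inv_of_pos hN0,
        ← ENNReal.ofReal_mul (by positivity), Finset.sum_add_distrib]
      congr 1
      simp [mul_add, hN0.ne']
    rw [h5]
    exact ENNReal.ofReal_add_le.trans (add_le_add_left h4 _)
  -- The identity `u⁺ + m = (u + m) + u⁻` undoes the shift by additions only; the finite term `m` is
  -- cancelled at the end.
  have hsplit : ∫⁻ a, ENNReal.ofReal (u a) ∂μ + ENNReal.ofReal m =
      ∫⁻ a, ENNReal.ofReal (u a + m) ∂μ + ∫⁻ a, ENNReal.ofReal (-u a) ∂μ := by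
    have h1 : ∀ a, ENNReal.ofReal (u a) + ENNReal.ofReal m =
        ENNReal.ofReal (u a + m) + ENNReal.ofReal (-u a) := by
      intro a
      rcases le_total 0 (u a) with h0 | h0
      · rw [ENNReal.ofReal_add h0 hm0, ENNReal.ofReal_of_nonpos (neg_nonpos.2 h0), add_zero]
      · rw [ENNReal.ofReal_of_nonpos h0, zero_add,
          ← ENNReal.ofReal_add (by linarith [hm a]) (neg_nonneg.2 h0)]
        congr 1
        ring
    have hneg : Measurable fun a => ENNReal.ofReal (-u a) := hmeas.neg.ennreal_ofReal
    rw [← lintegral_add_right _ hneg, ← lintegral_congr h1,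
      lintegral_add_right _ measurable_const]
    simp
  refine EReal.sub_le_of_le_add ?_
  rw [← EReal.coe_ennreal_add, EReal.coe_ennreal_le_coe_ennreal_iff]
  refine (ENNReal.add_le_add_iff_right (ENNReal.ofReal_ne_top (r := m))).1 ?_
  rw [hsplit, add_right_comm]
  exact add_le_add_left hshift _

theorem weakDualAdmissible_of_forall {d N : ℕ} (μ : Measure (CompEu d)) (u : C(CompEu d, ℝ))
    (hu : ∀ x : Fin N → CompEu d, compCoulombCost x ≠ ⊤ →
      meanMap N u x ≤ (compCoulombCost x).toReal) : WeakDualAdmissible N μ u := by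
  refine Eventually.of_forall fun x => ?_
  by_cases hx : compCoulombCost x = ⊤
  · rw [hx]; exact le_top
  · rw [← EReal.coe_ennreal_toReal hx]
    exact EReal.coe_le_coe_iff.2 (hu x hx)

/-! ### The duality formula -/

/-- The relaxed cost is bounded by the dual value over continuous functions. -/
theorem relaxedCost_le_sSup {d N : ℕ} (hd : 1 ≤ d) (hN : 1 ≤ N) {ρ : Measure (Eu d)}
    (hρ : ρ Set.univ ≤ 1) :
    ((relaxedCost N ρ : ℝ≥0∞) : EReal) ≤
      sSup {r : EReal | ∃ u : CompEu d → ℝ, Continuous u ∧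
        WeakDualAdmissible N (compMeasure ρ) u ∧ r = extIntegral (compMeasure ρ) u} := by
  have := isProbabilityMeasure_compMeasure hρ
  set s := sSup {r : EReal | ∃ u : CompEu d → ℝ, Continuous u ∧
    WeakDualAdmissible N (compMeasure ρ) u ∧ r = extIntegral (compMeasure ρ) u} with hs
  have hle : ∀ u : C(CompEu d, ℝ), (∀ x : Fin N → CompEu d, compCoulombCost x ≠ ⊤ →
      meanMap N u x ≤ (compCoulombCost x).toReal) →
      ((∫ x, u x ∂compMeasure ρ : ℝ) : EReal) ≤ s := fun u hu =>
    le_sSup ⟨u, u.continuous, weakDualAdmissible_of_forall _ u hu,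
      (extIntegral_eq_integral (integrable_continuousMap _ u)).symm⟩
  -- The potential `u = 0` is admissible, so the supremum is not `-∞`.
  have hs0 : 0 ≤ s := by simpa using hle 0 fun x _ => by simp
  by_cases htop : s = ⊤
  · rw [htop]; exact le_top
  have hcoe : (s.toReal : EReal) = s :=
    EReal.coe_toReal htop (ne_of_gt (lt_of_lt_of_le EReal.bot_lt_zero hs0))
  obtain ⟨P, hPprob, hP, hcost⟩ := exists_plan_of_dual_le hN (compMeasure ρ)
    (lowerSemicontinuous_compCoulombCost (d := d) (N := N)) s.toReal fun u hu => by
      rw [← EReal.coe_le_coe_iff, hcoe]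
      exact hle u hu
  have h := EReal.coe_ennreal_le_coe_ennreal_iff.2 ((relaxedCost_le hd hN hρ P hP).trans hcost)
  refine h.trans ?_
  rw [EReal.coe_ennreal_ofReal, max_eq_left (EReal.toReal_nonneg hs0), hcoe]

/-- Lower semicontinuous functions satisfying the weak dual constraint bound the relaxed cost
from below. -/
theorem WeakDualAdmissible.extIntegral_le_relaxedCost {d N : ℕ} (hN : 1 ≤ N)
    {ρ : Measure (Eu d)} (hρ : ρ Set.univ ≤ 1) {u : CompEu d → ℝ} (hu : LowerSemicontinuous u)
    (h : WeakDualAdmissible N (compMeasure ρ) u) :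
    extIntegral (compMeasure ρ) u ≤ ((relaxedCost N ρ : ℝ≥0∞) : EReal) := by
  have := isProbabilityMeasure_compMeasure hρ
  by_cases htop : relaxedCost N ρ = ⊤
  · rw [htop]; exact le_top
  -- Potentials admissible everywhere never exceed the relaxed cost, so `D` may be the relaxed cost
  -- itself. The resulting `P` is then tested against the larger class of potentials.
  obtain ⟨P, hPprob, hP, hcost⟩ := exists_plan_of_dual_le hN (compMeasure ρ)
    (lowerSemicontinuous_compCoulombCost (d := d) (N := N)) (relaxedCost N ρ).toReal
    fun u hu => (ENNReal.ofReal_le_iff_le_toReal htop).1 (ofReal_integral_le_relaxedCost hN hρ u hu)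
  rw [ENNReal.ofReal_toReal htop] at hcost
  exact (h.extIntegral_le hN hu P hP).trans (EReal.coe_ennreal_le_coe_ennreal_iff.2 hcost)

theorem relaxedCost_eq_sSup_lowerSemicontinuous {d N : ℕ} (hd : 1 ≤ d) (hN : 1 ≤ N)
    {ρ : Measure (Eu d)} (hρ : ρ Set.univ ≤ 1) :
    ((relaxedCost N ρ : ℝ≥0∞) : EReal) =
      sSup {r : EReal | ∃ u : CompEu d → ℝ, LowerSemicontinuous u ∧
        WeakDualAdmissible N (compMeasure ρ) u ∧ r = extIntegral (compMeasure ρ) u} := by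
  refine le_antisymm ((relaxedCost_le_sSup hd hN hρ).trans (sSup_le_sSup ?_)) (sSup_le ?_)
  · rintro r ⟨u, hu, h⟩
    exact ⟨u, hu.lowerSemicontinuous, h⟩
  · rintro r ⟨u, hu, h, rfl⟩
    exact h.extIntegral_le_relaxedCost hN hρ hu

theorem relaxedCost_eq_sSup_continuous {d N : ℕ} (hd : 1 ≤ d) (hN : 1 ≤ N)
    {ρ : Measure (Eu d)} (hρ : ρ Set.univ ≤ 1) :
    ((relaxedCost N ρ : ℝ≥0∞) : EReal) =
      sSup {r : EReal | ∃ u : CompEu d → ℝ, Continuous u ∧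
        WeakDualAdmissible N (compMeasure ρ) u ∧ r = extIntegral (compMeasure ρ) u} := by
  refine le_antisymm (relaxedCost_le_sSup hd hN hρ) (sSup_le ?_)
  rintro r ⟨u, hu, h, rfl⟩
  exact h.extIntegral_le_relaxedCost hN hρ hu.lowerSemicontinuous

/-! ### Atomic measures and the linear program -/

theorem atomWeight_nonneg {K : ℕ} {α : Fin K → ℝ} (hα : ∀ i, 0 ≤ α i) (hsum : ∑ i, α i ≤ 1)
    (k : Option (Fin K)) : 0 ≤ atomWeight α k := by
  cases k with
  | none => exact sub_nonneg.2 hsum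
  | some i => exact hα i

theorem atomNode_injective {d K : ℕ} {a : Fin K → Eu d} (ha : Function.Injective a) :
    Function.Injective (atomNode a) := by
  rintro (_ | i) (_ | j) h
  · rfl
  · exact absurd h (OnePoint.infty_ne_coe _)
  · exact absurd h (OnePoint.coe_ne_infty _)
  · exact congrArg some (ha (OnePoint.coe_injective h))

theorem atomicMeasure_univ {d K : ℕ} (a : Fin K → Eu d) {α : Fin K → ℝ} (hα : ∀ i, 0 ≤ α i) :
    atomicMeasure a α Set.univ = ENNReal.ofReal (∑ i, α i) := by
  rw [ENNReal.ofReal_sum_of_nonneg fun i _ => hα i]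
  simp [atomicMeasure]

theorem compMeasure_atomicMeasure {d K : ℕ} (a : Fin K → Eu d) {α : Fin K → ℝ}
    (hα : ∀ i, 0 ≤ α i) :
    compMeasure (atomicMeasure a α) =
      ∑ k, ENNReal.ofReal (atomWeight α k) • Measure.dirac (atomNode a k) := by
  have hm : Measurable fun x : Eu d => (x : CompEu d) := OnePoint.continuous_coe.measurable
  rw [Fintype.sum_option, add_comm, compMeasure, atomicMeasure_univ a hα]
  congr 1
  · rw [atomicMeasure, ← Measure.mapₗ_apply_of_measurable hm, map_sum]
    refine Finset.sum_congr rfl fun i _ => ?_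
    rw [Measure.mapₗ_apply_of_measurable hm, Measure.map_smul, Measure.map_dirac' hm]
    rfl
  · rw [atomWeight, ENNReal.ofReal_sub _ (Finset.sum_nonneg fun i _ => hα i), ENNReal.ofReal_one]
    rfl

theorem extIntegral_sum_dirac {X ι : Type*} [MeasurableSpace X] [MeasurableSingletonClass X]
    [Fintype ι] (p : ι → X) {w : ι → ℝ} (hw : ∀ k, 0 ≤ w k) (u : X → ℝ) :
    extIntegral (∑ k, ENNReal.ofReal (w k) • Measure.dirac (p k)) u =
      ((∑ k, w k * u (p k) : ℝ) : EReal) := by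
  have h : ∀ v : X → ℝ, ∫⁻ x, ENNReal.ofReal (v x)
      ∂(∑ k, ENNReal.ofReal (w k) • Measure.dirac (p k)) =
      ENNReal.ofReal (∑ k, w k * max (v (p k)) 0) := by
    intro v
    rw [lintegral_finsetSum_measure, ENNReal.ofReal_sum_of_nonneg fun k _ =>
      mul_nonneg (hw k) (le_max_right _ _)]
    refine Finset.sum_congr rfl fun k _ => ?_
    rw [lintegral_smul_measure, lintegral_dirac, ENNReal.ofReal_mul (hw k), ENNReal.ofReal_max,
      ENNReal.ofReal_zero, max_eq_left zero_le, smul_eq_mul]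
  have h0 : ∀ v : X → ℝ, 0 ≤ ∑ k, w k * max (v (p k)) 0 := fun v =>
    Finset.sum_nonneg fun k _ => mul_nonneg (hw k) (le_max_right _ _)
  rw [extIntegral, h, h, EReal.coe_ennreal_ofReal, EReal.coe_ennreal_ofReal,
    max_eq_left (h0 _), max_eq_left (h0 fun x => -u x), ← EReal.coe_sub, ← Finset.sum_sub_distrib]
  congr 1
  refine Finset.sum_congr rfl fun k _ => ?_
  rw [← mul_sub]
  congr 1
  rcases le_total 0 (u (p k)) with hk | hk
  · rw [max_eq_left hk, max_eq_right (neg_nonpos.2 hk), sub_zero]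
  · rw [max_eq_right hk, max_eq_left (neg_nonneg.2 hk), zero_sub, neg_neg]

/-- For an atomic measure, the weak dual constraint is the system of linear constraints. -/
theorem weakDualAdmissible_atomicMeasure_iff {d K N : ℕ} (a : Fin K → Eu d) {α : Fin K → ℝ}
    (hα : ∀ i, 0 ≤ α i) (u : CompEu d → ℝ) :
    WeakDualAdmissible N (compMeasure (atomicMeasure a α)) u ↔
      LPFeasible N a α (fun k => u (atomNode a k)) := by
  rw [compMeasure_atomicMeasure a hα]
  set μ : Measure (CompEu d) :=
    ∑ k, ENNReal.ofReal (atomWeight α k) • Measure.dirac (atomNode a k) with hμ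
  have hfin : IsFiniteMeasure μ := by
    refine ⟨?_⟩
    simp [hμ]
  constructor
  · intro h j hj
    by_contra hcon
    -- The tuple is an atom of the product measure, so an almost sure constraint must hold at it.
    have hpos : 0 < Measure.pi (fun _ : Fin N => μ)
        (Set.univ.pi fun i => {atomNode a (j i)}) := by
      rw [Measure.pi_pi]
      refine pos_iff_ne_zero.2 (Finset.prod_ne_zero_iff.2 fun i _ => ne_of_gt ?_)
      calc 0 < ENNReal.ofReal (atomWeight α (j i)) := ENNReal.ofReal_pos.2 (hj i)
        _ = (ENNReal.ofReal (atomWeight α (j i)) • Measure.dirac (atomNode a (j i)))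
            {atomNode a (j i)} := by simp
        _ ≤ μ {atomNode a (j i)} := Finset.single_le_sum
            (f := fun k => ENNReal.ofReal (atomWeight α k) • Measure.dirac (atomNode a k))
            (fun _ _ => Measure.zero_le _) (Finset.mem_univ (j i)) _
    refine hpos.ne' (measure_mono_null (fun x hx => ?_) h)
    obtain rfl : x = fun i => atomNode a (j i) := funext fun i => hx i trivial
    exact hcon
  · intro h
    have hnode : ∀ᵐ p ∂μ, ∃ k, 0 < atomWeight α k ∧ p = atomNode a k := by
      rw [ae_iff, hμ, Measure.finsetSum_apply]
      refine Finset.sum_eq_zero fun k _ => ?_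
      by_cases hk : 0 < atomWeight α k
      · have hn : atomNode a k ∉ {p | ¬∃ k, 0 < atomWeight α k ∧ p = atomNode a k} :=
          fun hn => hn ⟨k, hk, rfl⟩
        rw [Measure.smul_apply, Measure.dirac_apply, Set.indicator_of_notMem hn, smul_zero]
      · rw [ENNReal.ofReal_of_nonpos (not_lt.1 hk), zero_smul]
        rfl
    have hall : ∀ᵐ x ∂(Measure.pi fun _ : Fin N => μ),
        ∀ i, ∃ k, 0 < atomWeight α k ∧ x i = atomNode a k :=
      ae_all_iff.2 fun i =>
        (Measure.tendsto_eval_ae_ae (μ := fun _ : Fin N => μ) (i := i)).eventually hnode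
    filter_upwards [hall] with x hx
    choose j hj hxj using hx
    obtain rfl : x = fun i => atomNode a (j i) := funext hxj
    exact h j hj

/-- Prescribed values at finitely many points extend to a lower semicontinuous function. -/
theorem exists_lowerSemicontinuous_extension {X ι : Type*} [TopologicalSpace X] [T1Space X]
    [Finite ι] {p : ι → X} (hp : Function.Injective p) (y : ι → ℝ) :
    ∃ u : X → ℝ, LowerSemicontinuous u ∧ ∀ k, u (p k) = y k := by
  obtain ⟨M, hM⟩ := (Set.finite_range y).bddAbove
  -- Off the finite set the value is `M`, at least every `y k`, so the function can only drop at
  -- isolated points of that set.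
  refine ⟨Function.extend p y fun _ => M, fun x t ht => ?_, fun k => hp.extend_apply _ _ k⟩
  -- In the neighbourhood of `x` that avoids all other prescribed points, every value other than the
  -- one at `x` is `M`.
  have hopen : IsOpen (Set.range p \ {x})ᶜ :=
    ((Set.finite_range p).subset Set.sdiff_subset).isClosed.isOpen_compl
  filter_upwards [hopen.mem_nhds (show x ∈ (Set.range p \ {x})ᶜ by simp)] with z hz
  refine lt_of_lt_of_le ht ?_
  by_cases hzx : z = x
  · rw [hzx]
  have hzp : ¬∃ k, p k = z := fun h => hz ⟨h, hzx⟩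
  rw [Function.extend_apply' _ _ _ hzp]
  by_cases hxp : ∃ k, p k = x
  · obtain ⟨k, rfl⟩ := hxp
    rw [hp.extend_apply]
    exact hM ⟨k, rfl⟩
  · rw [Function.extend_apply' _ _ _ hxp]

theorem mainTheorem9 (d N : ℕ) (hd : 1 ≤ d) (hN : 1 ≤ N) :
    (∀ ρ : Measure (Eu d), ρ Set.univ ≤ 1 →
      ((relaxedCost N ρ : ℝ≥0∞) : EReal) =
          sSup {r : EReal | ∃ u : CompEu d → ℝ, LowerSemicontinuous u ∧
            WeakDualAdmissible N (compMeasure ρ) u ∧ r = extIntegral (compMeasure ρ) u} ∧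
      ((relaxedCost N ρ : ℝ≥0∞) : EReal) =
          sSup {r : EReal | ∃ u : CompEu d → ℝ, Continuous u ∧
            WeakDualAdmissible N (compMeasure ρ) u ∧ r = extIntegral (compMeasure ρ) u}) ∧
    (∀ (K : ℕ) (a : Fin K → Eu d) (α : Fin K → ℝ), Function.Injective a →
      (∀ i, 0 ≤ α i) → ∑ i, α i ≤ 1 →
      ((relaxedCost N (atomicMeasure a α) : ℝ≥0∞) : EReal) =
        sSup {r : EReal | ∃ y : Option (Fin K) → ℝ, LPFeasible N a α y ∧
          r = ((∑ k, atomWeight α k * y k : ℝ) : EReal)}) := by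
  refine ⟨fun ρ hρ => ⟨relaxedCost_eq_sSup_lowerSemicontinuous hd hN hρ,
    relaxedCost_eq_sSup_continuous hd hN hρ⟩, fun K a α ha hα hsum => ?_⟩
  have hρ : atomicMeasure a α Set.univ ≤ 1 := by
    rw [atomicMeasure_univ a hα]
    exact ENNReal.ofReal_le_one.2 hsum
  have hint : ∀ u : CompEu d → ℝ, extIntegral (compMeasure (atomicMeasure a α)) u =
      ((∑ k, atomWeight α k * u (atomNode a k) : ℝ) : EReal) := fun u => by
    rw [compMeasure_atomicMeasure a hα, extIntegral_sum_dirac _ (atomWeight_nonneg hα hsum)]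
  -- In the lower semicontinuous form, the extension of a feasible `y` requires no continuity; both
  -- constraint and objective depend only on the values at the nodes.
  rw [relaxedCost_eq_sSup_lowerSemicontinuous hd hN hρ]
  congr 1
  ext r
  constructor
  · rintro ⟨u, -, h, rfl⟩
    exact ⟨_, (weakDualAdmissible_atomicMeasure_iff a hα u).1 h, hint u⟩
  · rintro ⟨y, hy, rfl⟩
    obtain ⟨u, hu, huy⟩ := exists_lowerSemicontinuous_extension (atomNode_injective ha) y
    have hy' : y = fun k => u (atomNode a k) := funext fun k => (huy k).symm
    rw [hy'] at hy ⊢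
    exact ⟨u, hu, (weakDualAdmissible_atomicMeasure_iff a hα u).2 hy, (hint u).symm⟩
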